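/- Let $d\in\mathbb N$, and let $\{f(\cdot\,;\theta)\}_\theta$ be a family of probability density functions (with respect to Lebesgue measure) on $\mathbb R^d$. Fix two parameters $\theta_0,\theta$. Let $X_1,X_2,\dots$ be i.i.d. random vectors with density $f(\cdot\,;\theta_0)$ and $Y_1,Y_2,\dots$ i.i.d. random vectors with density $f(\cdot\,;\theta)$, the two sequences being independent of each other. For $n,m\ge 1$ put $\mathbf X_n=(X_i)_{i\le n}$, $\mathbf Y_m=(Y_j)_{j\le m}$, $\delta_1(x,y)=\|x-y\|_2$, and define the V-statistic $$\mathcal V_{\delta_1}(\mathbf X_n,\mathbf Y_m)=\frac{2}{mn}\sum_{i=1}^n\sum_{j=1}^m\|X_i-Y_j\|_2-\frac1{n^2}\sum_{i=1}^n\sum_{j=1}^n\|X_i-X_j\|_2-\frac1{m^2}\sum_{i=1}^m\sum_{j=1}^m\|Y_i-Y_j\|_2 .$$ Let $X$ and $Y$ be arbitrary elements of the first and of the second sequence, and suppose that $$\mathbb E\left(\|X\|_2^2\right)+\mathbb E\left(\|Y\|_2^2\right)<\infty .$$ Then the energy distance $$\mathcal E(X,Y)=2\,\mathbb E\|X-Y\|_2-\mathbb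 E\|X-X'\|_2-\mathbb E\|Y-Y'\|_2,$$ where $X',Y'$ have the same distributions as $X,Y$ respectively and $X,X',Y,Y'$ are independent, is well defined (the three expectations are finite); almost surely, $$\mathcal V_{\delta_1}(\mathbf X_n,\mathbf Y_m)\longrightarrow\mathcal E(X,Y)\qquad\text{as }\min\{n,m\}\to\infty ;$$ and $$\mathcal E(X,Y)=\frac{\Gamma\left(\frac{d+1}{2}\right)}{\pi^{(d+1)/2}}\int_{\mathbb R^d}\frac{\left|\varphi(t;\theta_0)-\varphi(t;\theta)\right|^2}{\|t\|_2^{d+1}}\,\mathrm dt ,$$ where the integral is finite and $\varphi(t;\theta)=\int_{\mathbb R^d}e^{i\langle t,x\rangle}f(x;\theta)\,\mathrm dx$ is the characteristic function of $f(\cdot\,;\theta)$. -/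

import Mathlib

open MeasureTheory ProbabilityTheory Filter Topology

namespace EnergyABC

/-- `f` is a probability density function (PDF) on `ℝ^d`, with respect to Lebesgue measure. -/
structure IsPDF {d : ℕ} (f : EuclideanSpace ℝ (Fin d) → ℝ) : Prop where
  measurable : Measurable f
  nonneg : ∀ x, 0 ≤ f x
  integrable : Integrable f
  integral_eq_one : ∫ x, f x = 1

/-- The distribution on `ℝ^d` with PDF `f`. -/
noncomputable def pdfLaw {d : ℕ} (f : EuclideanSpace ℝ (Fin d) → ℝ) :
    Measure (EuclideanSpace ℝ (Fin d)) :=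
  volume.withDensity (fun x => ENNReal.ofReal (f x))

/-- `X 0, X 1, …` are independent and identically distributed with PDF `f`. -/
structure IsIIDWithPDF {d : ℕ} {Ω : Type*} [MeasurableSpace Ω]
    (X : ℕ → Ω → EuclideanSpace ℝ (Fin d)) (f : EuclideanSpace ℝ (Fin d) → ℝ)
    (μ : Measure Ω) : Prop where
  indep : iIndepFun X μ
  law : ∀ i, HasLaw (X i) (pdfLaw f) μ

/-- The function `δ_β(x, y) = ‖x - y‖₂ ^ β`. -/
noncomputable def delta {d : ℕ} (β : ℝ) (x y : EuclideanSpace ℝ (Fin d)) : ℝ :=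
  ‖x - y‖ ^ β

/-- The characteristic function `φ(t) = ∫ exp(i⟨t, x⟩) f(x) dx` of the PDF `f`. -/
noncomputable def pdfCharFun {d : ℕ} (f : EuclideanSpace ℝ (Fin d) → ℝ)
    (t : EuclideanSpace ℝ (Fin d)) : ℂ :=
  charFun (pdfLaw f) t

/-- The energy statistic `2 E δ(X, Y) - E δ(X, X') - E δ(Y, Y')`, where `X'`, `Y'` are copies of
`X`, `Y` and `X, X', Y, Y'` are independent: each expectation is the integral of `δ` against the
product of the distributions of its two arguments. -/
noncomputable def energyStat {d : ℕ} {Ω : Type*} [MeasurableSpace Ω]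
    (δ : EuclideanSpace ℝ (Fin d) → EuclideanSpace ℝ (Fin d) → ℝ)
    (X Y : Ω → EuclideanSpace ℝ (Fin d)) (μ : Measure Ω) : ℝ :=
  2 * (∫ p, δ p.1 p.2 ∂((μ.map X).prod (μ.map Y)))
    - (∫ p, δ p.1 p.2 ∂((μ.map X).prod (μ.map X)))
    - (∫ p, δ p.1 p.2 ∂((μ.map Y).prod (μ.map Y)))

/-- The three expectations that enter the energy statistic are finite. -/
def EnergyStatExists {d : ℕ} {Ω : Type*} [MeasurableSpace Ω]
    (δ : EuclideanSpace ℝ (Fin d) → EuclideanSpace ℝ (Fin d) → ℝ)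
    (X Y : Ω → EuclideanSpace ℝ (Fin d)) (μ : Measure Ω) : Prop :=
  Integrable (fun p => δ p.1 p.2) ((μ.map X).prod (μ.map Y)) ∧
  Integrable (fun p => δ p.1 p.2) ((μ.map X).prod (μ.map X)) ∧
  Integrable (fun p => δ p.1 p.2) ((μ.map Y).prod (μ.map Y))

/-- The two-sample V-statistic of the samples `x` (of size `n`) and `y` (of size `m`). -/
noncomputable def vStat {d n m : ℕ}
    (δ : EuclideanSpace ℝ (Fin d) → EuclideanSpace ℝ (Fin d) → ℝ)
    (x : Fin n → EuclideanSpace ℝ (Fin d)) (y : Fin m → EuclideanSpace ℝ (Fin d)) : ℝ :=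
  2 / ((m : ℝ) * (n : ℝ)) * (∑ i, ∑ j, δ (x i) (y j))
    - 1 / (n : ℝ) ^ 2 * (∑ i, ∑ j, δ (x i) (x j))
    - 1 / (m : ℝ) ^ 2 * (∑ i, ∑ j, δ (y i) (y j))

end EnergyABC

namespace EnergyABC

/-! The Fourier formula rests on `lintegral_one_sub_cos_div_norm_pow`: the norm `‖x‖` is a constant
times the integral of `(1 - cos ⟪x, t⟫) / ‖t‖ ^ (d + 1)`. Put `x = X - Y` and average. Since `E cos
⟪X - Y, t⟫` is the real part of `φ_X(t)` times the conjugate of `φ_Y(t)`, the combination of three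
expectations in the energy becomes `|φ_X(t) - φ_Y(t)|²` under the integral. Nonnegativity of `1 -
cos` makes every interchange a Tonelli argument, so finiteness comes with the formula.

The almost sure limit reduces to the one-sample strong law. For a simple function `q`, the double
mean of `‖q (x i) - q (y j)‖` is a finite combination of products of empirical frequencies. As the
norm is 1-Lipschitz in each argument, replacing points by their quantised values costs at most the
one-sample means of `‖q u - u‖`, which are small in the limit. This is `tendsto_doubleMean_norm`; it
is deterministic in the two sequences, hence also covers `x = y` with its diagonal terms. -/

/-! ### One-dimensional Gamma-type integrals. -/

lemma lintegral_rpow_mul_exp_neg_mul {p r : ℝ} (hp : 0 < p) (hr : 0 < r) :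
    ∫⁻ s in Set.Ioi (0 : ℝ), ENNReal.ofReal (s ^ (p - 1) * Real.exp (-(r * s))) =
      ENNReal.ofReal ((1 / r) ^ p * Real.Gamma p) := by
  rw [← Real.integral_rpow_mul_exp_neg_mul_Ioi hp hr, ofReal_integral_eq_lintegral_ofReal]
  · have := integrableOn_rpow_mul_exp_neg_mul_rpow (p := 1) (s := p - 1) (b := r)
      (by linarith) one_pos hr
    simpa [IntegrableOn] using this
  · refine (ae_restrict_iff' measurableSet_Ioi).2 (ae_of_all _ fun s hs => ?_)
    have : 0 < s := hs
    simp only [Pi.zero_apply]; positivity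

/-- The substitution `u = 1 / s` turns this into the Gamma integral at `1 / 2`. -/
lemma lintegral_rpow_neg_mul_exp_neg_div {b : ℝ} (hb : 0 < b) :
    ∫⁻ s in Set.Ioi (0 : ℝ), ENNReal.ofReal (s ^ (-3 / 2 : ℝ) * Real.exp (-(b / s))) =
      ENNReal.ofReal (√Real.pi * b ^ (-1 / 2 : ℝ)) := by
  set g : ℝ → ℝ := fun u => u ^ ((1 / 2 : ℝ) - 1) * Real.exp (-(b * u)) with hg
  have hEq : Set.EqOn (fun s : ℝ => (|(-1 : ℝ)| * s ^ ((-1 : ℝ) - 1)) • g (s ^ (-1 : ℝ)))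
      (fun s => s ^ (-3 / 2 : ℝ) * Real.exp (-(b / s))) (Set.Ioi 0) := by
    intro s hs
    have hs : 0 < s := hs
    simp only [hg, abs_neg, abs_one, one_mul, smul_eq_mul]
    rw [← Real.rpow_mul hs.le, ← mul_assoc, ← Real.rpow_add hs, Real.rpow_neg_one, div_eq_mul_inv b]
    norm_num
  have hgi : IntegrableOn g (Set.Ioi 0) := by
    have := integrableOn_rpow_mul_exp_neg_mul_rpow (p := 1) (s := 1 / 2 - 1) (b := b)
      (by norm_num) one_pos hb
    simpa [hg] using this
  have hi := (integrableOn_Ioi_comp_rpow_iff g (p := -1) (by norm_num)).2 hgi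
  rw [integrableOn_congr_fun hEq measurableSet_Ioi] at hi
  rw [← ofReal_integral_eq_lintegral_ofReal hi, ← setIntegral_congr_fun measurableSet_Ioi hEq,
    integral_comp_rpow_Ioi g (by norm_num),
    Real.integral_rpow_mul_exp_neg_mul_Ioi (by norm_num) hb, Real.Gamma_one_half_eq, mul_comm,
    one_div b, Real.inv_rpow hb.le, ← Real.rpow_neg hb.le]
  · norm_num
  · refine (ae_restrict_iff' measurableSet_Ioi).2 (ae_of_all _ fun s hs => ?_)
    have : 0 < s := hs
    simp only [Pi.zero_apply]; positivity

lemma lintegral_rpow_neg_half_Ioc {a : ℝ} (ha : 0 ≤ a) :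
    ∫⁻ b in Set.Ioc 0 a, ENNReal.ofReal (√Real.pi * b ^ (-1 / 2 : ℝ)) =
      ENNReal.ofReal (2 * √Real.pi * √a) := by
  have hi := (intervalIntegral.intervalIntegrable_rpow' (a := 0) (b := a) (r := -1 / 2)
    (by norm_num)).const_mul (√Real.pi)
  rw [intervalIntegrable_iff_integrableOn_Ioc_of_le ha] at hi
  rw [← ofReal_integral_eq_lintegral_ofReal hi, ← intervalIntegral.integral_of_le ha,
    intervalIntegral.integral_const_mul, integral_rpow (Or.inl (by norm_num)),
    Real.sqrt_eq_rpow a]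
  · congr 1
    norm_num
    ring
  · refine (ae_restrict_iff' measurableSet_Ioc).2 (ae_of_all _ fun s hs => ?_)
    have : 0 < s := hs.1
    simp only [Pi.zero_apply]; positivity

lemma lintegral_exp_neg_div_Ioc {a s : ℝ} (ha : 0 ≤ a) (hs : 0 < s) :
    ∫⁻ b in Set.Ioc 0 a, ENNReal.ofReal (s ^ (-3 / 2 : ℝ) * Real.exp (-(b / s))) =
      ENNReal.ofReal (s ^ (-1 / 2 : ℝ) * (1 - Real.exp (-(a / s)))) := by
  have hc : Continuous fun b : ℝ => s ^ (-3 / 2 : ℝ) * Real.exp (-(b / s)) := by fun_prop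
  rw [← ofReal_integral_eq_lintegral_ofReal (hc.integrableOn_Ioc),
    ← intervalIntegral.integral_of_le ha]
  · have hd : ∀ b : ℝ, HasDerivAt (fun b => -(s ^ (-1 / 2 : ℝ) * Real.exp (-(b / s))))
        (s ^ (-3 / 2 : ℝ) * Real.exp (-(b / s))) b := by
      intro b
      have h := (((((hasDerivAt_id b).div_const s).fun_neg).exp).const_mul
        (s ^ (-1 / 2 : ℝ))).fun_neg
      refine h.congr_deriv ?_
      have : s ^ (-3 / 2 : ℝ) = s ^ (-1 / 2 : ℝ) * s⁻¹ := by
        rw [← Real.rpow_neg_one s, ← Real.rpow_add hs]; norm_num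
      rw [this]
      simp only [id]
      ring
    rw [intervalIntegral.integral_eq_sub_of_hasDerivAt (fun b _ => hd b) (hc.intervalIntegrable _ _)]
    congr 1
    simp
    ring
  · exact ae_of_all _ fun b => by simp only [Pi.zero_apply]; positivity

/-- Write `1 - exp (-a / s)` as the integral of `exp (-b / s) / s` over `0 < b ≤ a` and integrate in
`s` first. -/
lemma lintegral_rpow_mul_one_sub_exp {a : ℝ} (ha : 0 ≤ a) :
    ∫⁻ s in Set.Ioi (0 : ℝ), ENNReal.ofReal (s ^ (-1 / 2 : ℝ) * (1 - Real.exp (-(a / s)))) =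
      ENNReal.ofReal (2 * √Real.pi * √a) := by
  rw [← lintegral_rpow_neg_half_Ioc ha,
    setLIntegral_congr_fun measurableSet_Ioi
      (fun s hs => (lintegral_exp_neg_div_Ioc ha hs).symm), lintegral_lintegral_swap]
  · exact setLIntegral_congr_fun measurableSet_Ioc
      fun b hb => lintegral_rpow_neg_mul_exp_neg_div hb.1
  · apply Measurable.aemeasurable
    unfold Function.uncurry
    fun_prop

/-! ### The norm as an integral of `1 - cos`. -/

section NormIntegral

variable {V : Type*} [NormedAddCommGroup V] [InnerProductSpace ℝ V] [FiniteDimensional ℝ V]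
  [MeasurableSpace V] [BorelSpace V]

/-- Real part of the difference of two Gaussian Fourier integrals, at frequencies `0` and `x`. -/
lemma lintegral_one_sub_cos_mul_exp (x : V) {s : ℝ} (hs : 0 < s) :
    ∫⁻ t : V, ENNReal.ofReal ((1 - Real.cos (inner ℝ x t)) * Real.exp (-(s * ‖t‖ ^ 2))) =
      ENNReal.ofReal ((Real.pi / s) ^ (Module.finrank ℝ V / 2 : ℝ) *
        (1 - Real.exp (-(‖x‖ ^ 2 / 4 / s)))) := by
  have hsc : 0 < (s : ℂ).re := by simpa
  have i0 := GaussianFourier.integrable_cexp_neg_mul_sq_norm_add hsc 0 x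
  have i1 := GaussianFourier.integrable_cexp_neg_mul_sq_norm_add hsc Complex.I x
  have e0 := GaussianFourier.integral_cexp_neg_mul_sq_norm_add hsc 0 x
  have e1 := GaussianFourier.integral_cexp_neg_mul_sq_norm_add hsc Complex.I x
  have hre : ∀ t : V, (Complex.exp (-(s : ℂ) * (‖t‖ : ℂ) ^ 2 + 0 * (inner ℝ x t : ℝ)) -
      Complex.exp (-(s : ℂ) * (‖t‖ : ℂ) ^ 2 + Complex.I * (inner ℝ x t : ℝ))).re =
      (1 - Real.cos (inner ℝ x t)) * Real.exp (-(s * ‖t‖ ^ 2)) := by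
    intro t
    rw [Complex.sub_re, Complex.exp_re, Complex.exp_re]
    have h1 : ((s : ℂ) * (‖t‖ : ℂ) ^ 2) = ((s * ‖t‖ ^ 2 : ℝ) : ℂ) := by push_cast; ring
    simp only [neg_mul, h1, Complex.add_re, Complex.add_im, Complex.neg_re, Complex.neg_im,
      Complex.ofReal_re, Complex.ofReal_im, Complex.I_mul_re, Complex.I_mul_im, zero_mul,
      Complex.zero_re, Complex.zero_im]
    simp
    ring
  have hi := (i0.sub i1).re
  have hint := integral_re (i0.sub i1)
  simp only [Pi.sub_apply, RCLike.re_eq_complex_re] at hi hint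
  simp only [hre] at hi hint
  rw [← ofReal_integral_eq_lintegral_ofReal hi, hint, integral_sub i0 i1, e0, e1]
  · congr 1
    have h2 : ((Real.pi : ℂ) / s) ^ ((Module.finrank ℝ V : ℂ) / 2) =
        (((Real.pi / s) ^ (Module.finrank ℝ V / 2 : ℝ) : ℝ) : ℂ) := by
      rw [Complex.ofReal_cpow (by positivity)]; push_cast; rfl
    have h3 : Complex.exp (Complex.I ^ 2 * (‖x‖ : ℂ) ^ 2 / (4 * s)) =
        ((Real.exp (-(‖x‖ ^ 2 / 4 / s)) : ℝ) : ℂ) := by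
      push_cast
      rw [Complex.I_sq]
      congr 1
      field_simp
    rw [h2, h3]
    simp only [ne_eq, OfNat.ofNat_ne_zero, not_false_eq_true, zero_pow, zero_mul, zero_div,
      Complex.exp_zero]
    norm_cast
    ring
  · exact ae_of_all _ fun t => mul_nonneg (by linarith [Real.cos_le_one (inner ℝ x t)])
      (Real.exp_pos _).le

/-- The constant `π ^ ((d + 1) / 2) / Γ((d + 1) / 2)` of the representation of the norm as an
integral, where `d` is the dimension of the space. -/
noncomputable def normConst (V : Type*) [NormedAddCommGroup V] [InnerProductSpace ℝ V] : ℝ :=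
  Real.pi ^ (((Module.finrank ℝ V : ℝ) + 1) / 2) / Real.Gamma (((Module.finrank ℝ V : ℝ) + 1) / 2)

/-- The Gamma integral with `p = (d + 1) / 2` and rate `‖t‖ ^ 2` writes `‖t‖ ^ (-(d + 1))` as a
mixture of Gaussians; after Tonelli the `t`-integral is explicit. -/
lemma lintegral_one_sub_cos_div_norm_pow (x : V) :
    ∫⁻ t : V, ENNReal.ofReal ((1 - Real.cos (inner ℝ x t)) / ‖t‖ ^ (Module.finrank ℝ V + 1)) =
      ENNReal.ofReal (normConst V * ‖x‖) := by
  set d := Module.finrank ℝ V with hd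
  set p : ℝ := ((d : ℝ) + 1) / 2 with hpdef
  have hp : 0 < p := by positivity
  have hG := Real.Gamma_pos_of_pos hp
  have hcos : ∀ t : V, 0 ≤ 1 - Real.cos (inner ℝ x t) := fun t => by
    linarith [Real.cos_le_one (inner ℝ x t)]
  have h1 : ∀ t : V, ENNReal.ofReal ((1 - Real.cos (inner ℝ x t)) / ‖t‖ ^ (d + 1)) =
      ∫⁻ s in Set.Ioi (0 : ℝ), ENNReal.ofReal ((Real.Gamma p)⁻¹ * s ^ (p - 1)) *
        ENNReal.ofReal ((1 - Real.cos (inner ℝ x t)) * Real.exp (-(s * ‖t‖ ^ 2))) := by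
    intro t
    -- The Gamma integral needs a positive rate; at `t = 0` the factor `1 - cos 0` kills both sides.
    rcases eq_or_ne t 0 with rfl | ht
    · simp
    have ht : 0 < ‖t‖ := norm_pos_iff.2 ht
    have h : (1 - Real.cos (inner ℝ x t)) / ‖t‖ ^ (d + 1) =
        ((Real.Gamma p)⁻¹ * (1 - Real.cos (inner ℝ x t))) *
          ((1 / ‖t‖ ^ 2) ^ p * Real.Gamma p) := by
      have : (1 / ‖t‖ ^ 2) ^ p = (‖t‖ ^ (d + 1))⁻¹ := by
        rw [one_div, Real.inv_rpow (by positivity), ← Real.rpow_natCast, ← Real.rpow_natCast,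
          ← Real.rpow_mul ht.le, hpdef]
        congr 2
        push_cast
        ring
      rw [this]
      field_simp
    rw [h, ENNReal.ofReal_mul (mul_nonneg (by positivity) (hcos t)),
      ← lintegral_rpow_mul_exp_neg_mul hp (by positivity : 0 < ‖t‖ ^ 2),
      ← lintegral_const_mul _ (by fun_prop)]
    refine setLIntegral_congr_fun measurableSet_Ioi fun s hs => ?_
    have hs : 0 < s := hs
    rw [← ENNReal.ofReal_mul (mul_nonneg (by positivity) (hcos t)),
      ← ENNReal.ofReal_mul (by positivity), mul_comm s]
    congr 1
    ring
  simp_rw [h1]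
  rw [lintegral_lintegral_swap]
  · have h2 : Set.EqOn (fun s : ℝ => ∫⁻ t : V, ENNReal.ofReal ((Real.Gamma p)⁻¹ * s ^ (p - 1)) *
          ENNReal.ofReal ((1 - Real.cos (inner ℝ x t)) * Real.exp (-(s * ‖t‖ ^ 2))))
        (fun s => ENNReal.ofReal ((Real.Gamma p)⁻¹ * Real.pi ^ ((d : ℝ) / 2)) *
          ENNReal.ofReal (s ^ (-1 / 2 : ℝ) * (1 - Real.exp (-(‖x‖ ^ 2 / 4 / s)))))
        (Set.Ioi 0) := by
      intro s hs
      have hs : 0 < s := hs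
      simp only
      rw [lintegral_const_mul _ (by fun_prop), lintegral_one_sub_cos_mul_exp x hs,
        ← ENNReal.ofReal_mul (by positivity), ← ENNReal.ofReal_mul (by positivity)]
      congr 1
      -- The dimension cancels from the power of `s`, as `p - 1 - d / 2 = -1 / 2`.
      have : s ^ (p - 1) * (Real.pi / s) ^ ((d : ℝ) / 2) =
          Real.pi ^ ((d : ℝ) / 2) * s ^ (-1 / 2 : ℝ) := by
        rw [Real.div_rpow Real.pi_pos.le hs.le, div_eq_mul_inv, ← Real.rpow_neg hs.le,
          mul_left_comm, ← Real.rpow_add hs, hpdef]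
        congr 2
        ring
      rw [← hd]
      linear_combination (Real.Gamma p)⁻¹ * (1 - Real.exp (-(‖x‖ ^ 2 / 4 / s))) * this
    rw [setLIntegral_congr_fun measurableSet_Ioi h2, lintegral_const_mul _ (by fun_prop),
      lintegral_rpow_mul_one_sub_exp (by positivity), ← ENNReal.ofReal_mul (by positivity)]
    congr 1
    have h3 : √(‖x‖ ^ 2 / 4) = ‖x‖ / 2 := by
      rw [show ‖x‖ ^ 2 / 4 = (‖x‖ / 2) ^ 2 by ring, Real.sqrt_sq (by positivity)]
    have h4 : Real.pi ^ p = Real.pi ^ ((d : ℝ) / 2) * √Real.pi := by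
      rw [Real.sqrt_eq_rpow, ← Real.rpow_add Real.pi_pos, hpdef]
      congr 1
      ring
    rw [normConst, ← hd, ← hpdef, h3, h4]
    ring
  · apply Measurable.aemeasurable
    unfold Function.uncurry
    fun_prop

end NormIntegral

/-! ### Energy in terms of characteristic functions. -/

section CharFun

variable {V : Type*} [NormedAddCommGroup V] [InnerProductSpace ℝ V] [FiniteDimensional ℝ V]
  [MeasurableSpace V] [BorelSpace V] {P Q : Measure V}

/-- The expectation of `1 - cos ⟪X - Y, t⟫` for independent `X` and `Y` with laws `P` and `Q`. -/
noncomputable def oneSubCos (P Q : Measure V) (t : V) : ℝ :=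
  ∫ p, (1 - Real.cos (inner ℝ (p.1 - p.2) t)) ∂(P.prod Q)

lemma re_charFun_mul_conj (P Q : Measure V) [IsProbabilityMeasure P] [IsProbabilityMeasure Q]
    (t : V) :
    (charFun P t * (starRingEnd ℂ) (charFun Q t)).re = 1 - oneSubCos P Q t := by
  have hcos : Integrable (fun p : V × V => Real.cos (inner ℝ (p.1 - p.2) t)) (P.prod Q) := by
    refine Integrable.of_bound (by fun_prop) 1 (ae_of_all _ fun p => ?_)
    exact Real.abs_cos_le_one _
  rw [oneSubCos, integral_sub (integrable_const _) hcos, charFun_apply, charFun_apply,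
    ← integral_conj, ← integral_prod_mul]
  have hexp : ∀ p : V × V, Complex.exp (↑(inner ℝ p.1 t) * Complex.I) *
      (starRingEnd ℂ) (Complex.exp (↑(inner ℝ p.2 t) * Complex.I)) =
      Complex.exp (↑(inner ℝ (p.1 - p.2) t) * Complex.I) := by
    intro p
    rw [← Complex.exp_conj, ← Complex.exp_add, inner_sub_left]
    congr 1
    simp
    ring
  simp_rw [hexp]
  have hi : Integrable (fun p : V × V => Complex.exp (↑(inner ℝ (p.1 - p.2) t) * Complex.I))
      (P.prod Q) := by
    refine Integrable.of_bound (by fun_prop) 1 (ae_of_all _ fun p => ?_)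
    rw [Complex.norm_exp_ofReal_mul_I]
  have := integral_re hi
  simp only [RCLike.re_eq_complex_re, Complex.exp_ofReal_mul_I_re] at this
  rw [← this]
  simp

/-- Expand the square; the constants `1` from `re_charFun_mul_conj` cancel, as `1 + 1 - 2 = 0`. -/
lemma norm_charFun_sub_sq (P Q : Measure V) [IsProbabilityMeasure P] [IsProbabilityMeasure Q]
    (t : V) :
    ‖charFun P t - charFun Q t‖ ^ 2 =
      2 * oneSubCos P Q t - oneSubCos P P t - oneSubCos Q Q t := by
  have h1 := re_charFun_mul_conj P Q t
  have h2 := re_charFun_mul_conj P P t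
  have h3 := re_charFun_mul_conj Q Q t
  rw [Complex.sq_norm, Complex.normSq_apply]
  simp only [Complex.mul_re, Complex.conj_re, Complex.conj_im, Complex.sub_re,
    Complex.sub_im] at h1 h2 h3 ⊢
  linarith

lemma normConst_pos {V : Type*} [NormedAddCommGroup V] [InnerProductSpace ℝ V] : 0 < normConst V :=
  div_pos (by positivity) (Real.Gamma_pos_of_pos (by positivity))

/-- Licenses Fubini below: integrating the nonnegative integrand over `t` first leaves a multiple of
`‖p.1 - p.2‖`. -/
lemma integrable_one_sub_cos_prod (h : Integrable (fun p : V × V => ‖p.1 - p.2‖) (P.prod Q)) :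
    Integrable (fun z : (V × V) × V => (1 - Real.cos (inner ℝ (z.1.1 - z.1.2) z.2)) /
      ‖z.2‖ ^ (Module.finrank ℝ V + 1)) ((P.prod Q).prod volume) := by
  have hm : Measurable (fun z : (V × V) × V => (1 - Real.cos (inner ℝ (z.1.1 - z.1.2) z.2)) /
      ‖z.2‖ ^ (Module.finrank ℝ V + 1)) := by fun_prop
  refine ⟨hm.aestronglyMeasurable, ?_⟩
  rw [hasFiniteIntegral_iff_ofReal, lintegral_prod _ (by fun_prop)]
  · simp_rw [lintegral_one_sub_cos_div_norm_pow]
    exact (hasFiniteIntegral_iff_ofReal (ae_of_all _ fun p =>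
      mul_nonneg normConst_pos.le (norm_nonneg _))).1 (h.const_mul (normConst V)).2
  · exact ae_of_all _ fun z => div_nonneg
      (by linarith [Real.cos_le_one (inner ℝ (z.1.1 - z.1.2) z.2)]) (by positivity)

lemma integral_one_sub_cos_div_norm_pow (x : V) :
    ∫ t : V, (1 - Real.cos (inner ℝ x t)) / ‖t‖ ^ (Module.finrank ℝ V + 1) =
      normConst V * ‖x‖ := by
  rw [integral_eq_lintegral_of_nonneg_ae, lintegral_one_sub_cos_div_norm_pow,
    ENNReal.toReal_ofReal (mul_nonneg normConst_pos.le (norm_nonneg _))]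
  · exact ae_of_all _ fun t => div_nonneg
      (by linarith [Real.cos_le_one (inner ℝ x t)]) (by positivity)
  · exact Measurable.aestronglyMeasurable (by fun_prop)

lemma oneSubCos_div {V : Type*} [NormedAddCommGroup V] [InnerProductSpace ℝ V]
    [MeasurableSpace V] (P Q : Measure V) (t : V) (c : ℝ) :
    oneSubCos P Q t / c = ∫ p, (1 - Real.cos (inner ℝ (p.1 - p.2) t)) / c ∂(P.prod Q) := by
  rw [oneSubCos, integral_div]

variable [IsProbabilityMeasure P] [IsProbabilityMeasure Q]

lemma integrable_oneSubCos_div (h : Integrable (fun p : V × V => ‖p.1 - p.2‖) (P.prod Q)) :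
    Integrable (fun t : V => oneSubCos P Q t / ‖t‖ ^ (Module.finrank ℝ V + 1)) := by
  simp_rw [oneSubCos_div]
  exact (integrable_one_sub_cos_prod h).integral_prod_right

lemma integral_oneSubCos_div (h : Integrable (fun p : V × V => ‖p.1 - p.2‖) (P.prod Q)) :
    ∫ t : V, oneSubCos P Q t / ‖t‖ ^ (Module.finrank ℝ V + 1) =
      normConst V * ∫ p, ‖p.1 - p.2‖ ∂(P.prod Q) := by
  simp_rw [oneSubCos_div]
  rw [← integral_integral_swap (integrable_one_sub_cos_prod h)]
  simp_rw [integral_one_sub_cos_div_norm_pow]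
  rw [integral_const_mul]

theorem integrable_norm_charFun_sub_sq_div
    (hPQ : Integrable (fun p : V × V => ‖p.1 - p.2‖) (P.prod Q))
    (hPP : Integrable (fun p : V × V => ‖p.1 - p.2‖) (P.prod P))
    (hQQ : Integrable (fun p : V × V => ‖p.1 - p.2‖) (Q.prod Q)) :
    Integrable (fun t : V => ‖charFun P t - charFun Q t‖ ^ 2 /
      ‖t‖ ^ (Module.finrank ℝ V + 1)) := by
  simp_rw [norm_charFun_sub_sq, sub_div, mul_div_assoc]
  exact (((integrable_oneSubCos_div hPQ).const_mul 2).sub (integrable_oneSubCos_div hPP)).sub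
    (integrable_oneSubCos_div hQQ)

theorem integral_norm_charFun_sub_sq_div
    (hPQ : Integrable (fun p : V × V => ‖p.1 - p.2‖) (P.prod Q))
    (hPP : Integrable (fun p : V × V => ‖p.1 - p.2‖) (P.prod P))
    (hQQ : Integrable (fun p : V × V => ‖p.1 - p.2‖) (Q.prod Q)) :
    ∫ t : V, ‖charFun P t - charFun Q t‖ ^ 2 / ‖t‖ ^ (Module.finrank ℝ V + 1) =
      normConst V * (2 * (∫ p, ‖p.1 - p.2‖ ∂(P.prod Q)) - (∫ p, ‖p.1 - p.2‖ ∂(P.prod P)) -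
        ∫ p, ‖p.1 - p.2‖ ∂(Q.prod Q)) := by
  have iPQ := (integrable_oneSubCos_div hPQ).const_mul 2
  have iPP := integrable_oneSubCos_div hPP
  simp_rw [norm_charFun_sub_sq, sub_div, mul_div_assoc]
  have iS : Integrable fun t : V => 2 * (oneSubCos P Q t / ‖t‖ ^ (Module.finrank ℝ V + 1)) -
      oneSubCos P P t / ‖t‖ ^ (Module.finrank ℝ V + 1) := iPQ.sub iPP
  rw [integral_sub iS (integrable_oneSubCos_div hQQ), integral_sub iPQ iPP,
    integral_const_mul, integral_oneSubCos_div hPQ, integral_oneSubCos_div hPP,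
    integral_oneSubCos_div hQQ]
  ring

end CharFun

/-! ### Double means of simple functions, and the quantisation error. -/

section StrongLaw

variable {V : Type*} [NormedAddCommGroup V] [MeasurableSpace V]

/-- The mean of `φ` over the first `n` terms of the sequence `x`. -/
noncomputable def empMean {V : Type*} (x : ℕ → V) (φ : V → ℝ) (n : ℕ) : ℝ :=
  (∑ i ∈ Finset.range n, φ (x i)) / n

/-- The means over `x` of the indicators of the fibres of `q` and of the distance to `q` converge
to the integrals with respect to `P`. -/
structure EmpTendsto (x : ℕ → V) (P : Measure V) (q : SimpleFunc V V) : Prop where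
  fibre : ∀ a ∈ q.range, Tendsto (empMean x ((q ⁻¹' {a}).indicator 1)) atTop
    (𝓝 (∫ u, (q ⁻¹' {a}).indicator 1 u ∂P))
  dist : Tendsto (empMean x (fun u => ‖q u - u‖)) atTop (𝓝 (∫ u, ‖q u - u‖ ∂P))

/-- Separates `u` from `v`, so that double means factor into products of single means. -/
lemma norm_simpleFunc_sub (q r : SimpleFunc V V) (u v : V) :
    ‖q u - r v‖ = ∑ a ∈ q.range, ∑ b ∈ r.range,
      ‖a - b‖ * ((q ⁻¹' {a}).indicator 1 u * (r ⁻¹' {b}).indicator 1 v) := by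
  rw [Finset.sum_eq_single_of_mem (q u) (q.mem_range_self u),
    Finset.sum_eq_single_of_mem (r v) (r.mem_range_self v)]
  · simp
  · intro b _ hb
    simp [Set.indicator_of_notMem (s := r ⁻¹' {b}) (a := v) (by simpa using hb.symm)]
  · intro a _ ha
    simp [Set.indicator_of_notMem (s := q ⁻¹' {a}) (a := u) (by simpa using ha.symm)]

lemma tendsto_doubleMean_simpleFunc {x y : ℕ → V} {P Q : Measure V} [IsProbabilityMeasure P]
    [IsProbabilityMeasure Q] {q r : SimpleFunc V V} (hx : EmpTendsto x P q)
    (hy : EmpTendsto y Q r) :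
    Tendsto (fun p : ℕ × ℕ => (∑ i ∈ Finset.range p.1, ∑ j ∈ Finset.range p.2,
      ‖q (x i) - r (y j)‖) / ((p.1 : ℝ) * p.2)) (atTop ×ˢ atTop)
      (𝓝 (∫ p, ‖q p.1 - r p.2‖ ∂(P.prod Q))) := by
  have hI : ∀ (R : Measure V) [IsProbabilityMeasure R] (s : SimpleFunc V V) (a : V),
      Integrable ((s ⁻¹' {a}).indicator (1 : V → ℝ)) R := fun R _ s a =>
    (integrable_const (1 : ℝ)).indicator (s.measurableSet_fiber a)
  have hint : ∫ p, ‖q p.1 - r p.2‖ ∂(P.prod Q) = ∑ a ∈ q.range, ∑ b ∈ r.range,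
      ‖a - b‖ * ((∫ u, (q ⁻¹' {a}).indicator 1 u ∂P) * ∫ v, (r ⁻¹' {b}).indicator 1 v ∂Q) := by
    have hab : ∀ a b : V, Integrable (fun p : V × V =>
        ‖a - b‖ * ((q ⁻¹' {a}).indicator 1 p.1 * (r ⁻¹' {b}).indicator 1 p.2)) (P.prod Q) :=
      fun a b => ((hI P q a).mul_prod (hI Q r b)).const_mul _
    simp_rw [norm_simpleFunc_sub q r]
    rw [integral_finsetSum _ fun a _ => integrable_finsetSum _ fun b _ => hab a b]
    refine Finset.sum_congr rfl fun a _ => ?_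
    rw [integral_finsetSum _ fun b _ => hab a b]
    refine Finset.sum_congr rfl fun b _ => ?_
    rw [integral_const_mul, integral_prod_mul]
  have hsum : ∀ p : ℕ × ℕ, (∑ i ∈ Finset.range p.1, ∑ j ∈ Finset.range p.2,
      ‖q (x i) - r (y j)‖) / ((p.1 : ℝ) * p.2) = ∑ a ∈ q.range, ∑ b ∈ r.range,
      ‖a - b‖ * (empMean x ((q ⁻¹' {a}).indicator 1) p.1 *
        empMean y ((r ⁻¹' {b}).indicator 1) p.2) := by
    intro p
    simp_rw [norm_simpleFunc_sub q r, empMean, div_mul_div_comm, Finset.sum_mul_sum]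
    have h1 : ∀ i, ∑ j ∈ Finset.range p.2, ∑ a ∈ q.range, ∑ b ∈ r.range,
        ‖a - b‖ * ((q ⁻¹' {a}).indicator (1 : V → ℝ) (x i) * (r ⁻¹' {b}).indicator 1 (y j)) =
        ∑ a ∈ q.range, ∑ b ∈ r.range, ∑ j ∈ Finset.range p.2,
        ‖a - b‖ * ((q ⁻¹' {a}).indicator 1 (x i) * (r ⁻¹' {b}).indicator 1 (y j)) := by
      intro i
      rw [Finset.sum_comm]
      exact Finset.sum_congr rfl fun a _ => Finset.sum_comm
    simp_rw [h1]
    rw [Finset.sum_comm, Finset.sum_div]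
    refine Finset.sum_congr rfl fun a _ => ?_
    rw [Finset.sum_comm, Finset.sum_div]
    refine Finset.sum_congr rfl fun b _ => ?_
    simp_rw [← Finset.mul_sum]
    rw [mul_div_assoc]
  simp_rw [hsum, hint]
  refine tendsto_finsetSum _ fun a ha => tendsto_finsetSum _ fun b hb => ?_
  exact (((hx.fibre a ha).comp tendsto_fst).mul ((hy.fibre b hb).comp tendsto_snd)).const_mul _

lemma abs_norm_sub_sub_norm_sub_le {V : Type*} [NormedAddCommGroup V] (a b a' b' : V) :
    |‖a - b‖ - ‖a' - b'‖| ≤ ‖a' - a‖ + ‖b' - b‖ :=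
  calc |‖a - b‖ - ‖a' - b'‖| ≤ ‖(a - b) - (a' - b')‖ := abs_norm_sub_norm_le _ _
    _ = ‖(b' - b) - (a' - a)‖ := by congr 1; abel
    _ ≤ ‖a' - a‖ + ‖b' - b‖ := (norm_sub_le _ _).trans_eq (add_comm _ _)

lemma abs_doubleMean_sub_le (x y : ℕ → V) (q r : SimpleFunc V V) {n m : ℕ} (hn : 0 < n)
    (hm : 0 < m) :
    |(∑ i ∈ Finset.range n, ∑ j ∈ Finset.range m, ‖x i - y j‖) / ((n : ℝ) * m) -
      (∑ i ∈ Finset.range n, ∑ j ∈ Finset.range m, ‖q (x i) - r (y j)‖) / ((n : ℝ) * m)| ≤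
      empMean x (fun u => ‖q u - u‖) n + empMean y (fun u => ‖r u - u‖) m := by
  have hn' : (0 : ℝ) < n := by exact_mod_cast hn
  have hm' : (0 : ℝ) < m := by exact_mod_cast hm
  have hR : empMean x (fun u => ‖q u - u‖) n + empMean y (fun u => ‖r u - u‖) m =
      (∑ i ∈ Finset.range n, ∑ j ∈ Finset.range m, (‖q (x i) - x i‖ + ‖r (y j) - y j‖)) /
        ((n : ℝ) * m) := by
    simp only [empMean, Finset.sum_add_distrib, Finset.sum_const, Finset.card_range, nsmul_eq_mul,
      ← Finset.mul_sum]
    field_simp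
  rw [hR, ← sub_div, abs_div, abs_of_pos (by positivity : (0 : ℝ) < n * m)]
  gcongr
  simp_rw [← Finset.sum_sub_distrib]
  refine (Finset.abs_sum_le_sum_abs _ _).trans (Finset.sum_le_sum fun i _ => ?_)
  refine (Finset.abs_sum_le_sum_abs _ _).trans (Finset.sum_le_sum fun j _ => ?_)
  exact abs_norm_sub_sub_norm_sub_le _ _ _ _

end StrongLaw

/-! ### From the strong law to double means of the norm. -/

section StrongLawNorm

lemma integrable_norm_sub_prod {V : Type*} [NormedAddCommGroup V] [MeasurableSpace V]
    {P Q : Measure V} [IsProbabilityMeasure P] [IsProbabilityMeasure Q]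
    (hP : Integrable id P) (hQ : Integrable id Q) :
    Integrable (fun p : V × V => ‖p.1 - p.2‖) (P.prod Q) :=
  ((hP.comp_fst Q).sub (hQ.comp_snd P)).norm

lemma ae_tendsto_empMean {V : Type*} [MeasurableSpace V] {Ω : Type*} [MeasurableSpace Ω]
    {μ : Measure Ω} {X : ℕ → Ω → V} {P : Measure V}
    (hind : iIndepFun X μ) (hlaw : ∀ i, HasLaw (X i) P μ) {φ : V → ℝ}
    (hφ : Measurable φ) (hint : Integrable φ P) :
    ∀ᵐ ω ∂μ, Tendsto (empMean (fun i => X i ω) φ) atTop (𝓝 (∫ u, φ u ∂P)) := by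
  have hid : ∀ i, IdentDistrib (X i) (X 0) μ μ := fun i =>
    ⟨(hlaw i).aemeasurable, (hlaw 0).aemeasurable, by rw [(hlaw i).map_eq, (hlaw 0).map_eq]⟩
  have h := strong_law_ae_real (μ := μ) (fun i ω => φ (X i ω))
    ((hlaw 0).map_eq ▸ hint |>.comp_aemeasurable (hlaw 0).aemeasurable)
    (fun i j hij => (hind.indepFun hij).comp hφ hφ) (fun i => (hid i).comp hφ)
  have hE : ∫ ω, φ (X 0 ω) ∂μ = ∫ u, φ u ∂P := by
    rw [← (hlaw 0).map_eq, integral_map (hlaw 0).aemeasurable hφ.aestronglyMeasurable]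
  rw [hE] at h
  exact h

variable {V : Type*} [NormedAddCommGroup V] [MeasurableSpace V] [BorelSpace V]
  [SecondCountableTopology V]

variable (V) in
/-- Simple functions that converge to the identity. -/
noncomputable def quantizer (k : ℕ) : SimpleFunc V V :=
  SimpleFunc.approxOn id measurable_id Set.univ 0 (Set.mem_univ 0) k

lemma integrable_norm_quantizer_sub {P : Measure V} [IsProbabilityMeasure P]
    (hP : Integrable id P) (k : ℕ) : Integrable (fun u => ‖quantizer V k u - u‖) P :=
  ((SimpleFunc.integrable_of_isFiniteMeasure (quantizer V k)).sub hP).norm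

lemma tendsto_integral_norm_quantizer_sub {P : Measure V} [IsProbabilityMeasure P]
    (hP : Integrable id P) :
    Tendsto (fun k => ∫ u, ‖quantizer V k u - u‖ ∂P) atTop (𝓝 0) := by
  -- With base point `0`, the required finiteness of `∫ ‖u - 0‖` is the first moment.
  have h := SimpleFunc.tendsto_approxOn_L1_enorm (f := id) (μ := P) measurable_id
    (Set.mem_univ (0 : V)) (by simp) (by simpa only [sub_zero] using hP.2)
  have h2 := (ENNReal.tendsto_toReal ENNReal.zero_ne_top).comp h
  refine h2.congr fun k => ?_
  exact (integral_norm_eq_lintegral_enorm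
    ((SimpleFunc.integrable_of_isFiniteMeasure (quantizer V k)).sub hP).aestronglyMeasurable).symm

lemma abs_integral_norm_sub_quantizer_le {P Q : Measure V} [IsProbabilityMeasure P]
    [IsProbabilityMeasure Q] (hP : Integrable id P) (hQ : Integrable id Q) (k : ℕ) :
    |(∫ p, ‖p.1 - p.2‖ ∂(P.prod Q)) -
      ∫ p, ‖quantizer V k p.1 - quantizer V k p.2‖ ∂(P.prod Q)| ≤
      (∫ u, ‖quantizer V k u - u‖ ∂P) + ∫ u, ‖quantizer V k u - u‖ ∂Q := by
  set q := quantizer V k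
  have i1 := integrable_norm_sub_prod hP hQ
  have i2 : Integrable (fun p : V × V => ‖q p.1 - q p.2‖) (P.prod Q) :=
    (((SimpleFunc.integrable_of_isFiniteMeasure q).comp_fst Q).sub
      ((SimpleFunc.integrable_of_isFiniteMeasure q).comp_snd P)).norm
  have i3 := (integrable_norm_quantizer_sub hP k).comp_fst Q
  have i4 := (integrable_norm_quantizer_sub hQ k).comp_snd P
  have e3 : ∫ p, ‖q p.1 - p.1‖ ∂(P.prod Q) = ∫ u, ‖q u - u‖ ∂P := by
    rw [integral_fun_fst (fun u => ‖q u - u‖)]; simp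
  have e4 : ∫ p, ‖q p.2 - p.2‖ ∂(P.prod Q) = ∫ u, ‖q u - u‖ ∂Q := by
    rw [integral_fun_snd (fun u => ‖q u - u‖)]; simp
  rw [← integral_sub i1 i2, ← e3, ← e4, ← integral_add i3 i4]
  refine (abs_integral_le_integral_abs).trans (integral_mono (i1.sub i2).abs (i3.add i4) ?_)
  exact fun p => abs_norm_sub_sub_norm_sub_le _ _ _ _

/-- The mean of `‖x i - y j‖` over two samples converges if all quantised means do. -/
lemma tendsto_doubleMean_norm {x y : ℕ → V} {P Q : Measure V} [IsProbabilityMeasure P]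
    [IsProbabilityMeasure Q] (hP : Integrable id P) (hQ : Integrable id Q)
    (hx : ∀ k, EmpTendsto x P (quantizer V k)) (hy : ∀ k, EmpTendsto y Q (quantizer V k)) :
    Tendsto (fun p : ℕ × ℕ => (∑ i ∈ Finset.range p.1, ∑ j ∈ Finset.range p.2,
      ‖x i - y j‖) / ((p.1 : ℝ) * p.2)) (atTop ×ˢ atTop)
      (𝓝 (∫ p, ‖p.1 - p.2‖ ∂(P.prod Q))) := by
  rw [Metric.tendsto_nhds]
  intro ε hε
  -- Five errors of `ε / 5`: quantisation in both empirical means and both integrals, plus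
  -- convergence of the quantised double mean.
  obtain ⟨k, hkP, hkQ⟩ := (((tendsto_integral_norm_quantizer_sub hP).eventually_lt_const
    (show (0 : ℝ) < ε / 5 by positivity)).and
    ((tendsto_integral_norm_quantizer_sub hQ).eventually_lt_const
    (show (0 : ℝ) < ε / 5 by positivity))).exists
  have h1 := ((hx k).dist.eventually_lt_const hkP).and (eventually_gt_atTop 0)
  have h2 := ((hy k).dist.eventually_lt_const hkQ).and (eventually_gt_atTop 0)
  have h3 := (Metric.tendsto_nhds.1 (tendsto_doubleMean_simpleFunc (hx k) (hy k))) (ε / 5)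
    (by positivity)
  filter_upwards [h1.prod_mk h2, h3] with p hp hp3
  have h4 := abs_doubleMean_sub_le x y (quantizer V k) (quantizer V k) hp.1.2 hp.2.2
  have h5 := abs_integral_norm_sub_quantizer_le hP hQ k
  have h6 := hp.1.1
  have h7 := hp.2.1
  rw [Real.dist_eq] at hp3 ⊢
  rw [abs_le] at h4 h5
  rw [abs_lt] at hp3 ⊢
  constructor <;> linarith [h4.1, h4.2, h5.1, h5.2, hp3.1, hp3.2]

variable {Ω : Type*} [MeasurableSpace Ω] {μ : Measure Ω} {X : ℕ → Ω → V} {P : Measure V}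

/-- Only countably many test functions occur (finitely many for each `k`), so one null set suffices.
-/
lemma ae_empTendsto [IsProbabilityMeasure P] (hind : iIndepFun X μ)
    (hlaw : ∀ i, HasLaw (X i) P μ) (hP : Integrable id P) :
    ∀ᵐ ω ∂μ, ∀ k, EmpTendsto (fun i => X i ω) P (quantizer V k) := by
  refine ae_all_iff.2 fun k => ?_
  have h1 : ∀ᵐ ω ∂μ, ∀ a ∈ (quantizer V k).range,
      Tendsto (empMean (fun i => X i ω) ((quantizer V k ⁻¹' {a}).indicator 1)) atTop
        (𝓝 (∫ u, (quantizer V k ⁻¹' {a}).indicator 1 u ∂P)) := by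
    refine (ae_ball_iff (quantizer V k).range.countable_toSet).2 fun a _ => ?_
    exact ae_tendsto_empMean hind hlaw
      (measurable_one.indicator ((quantizer V k).measurableSet_fiber a))
      ((integrable_const (1 : ℝ)).indicator ((quantizer V k).measurableSet_fiber a))
  have h2 := ae_tendsto_empMean hind hlaw (φ := fun u => ‖quantizer V k u - u‖)
    ((quantizer V k).measurable.sub measurable_id).norm (integrable_norm_quantizer_sub hP k)
  filter_upwards [h1, h2] with ω hω1 hω2 using ⟨hω1, hω2⟩

end StrongLawNorm

/-! ### Densities, moments and the theorem. -/

variable {d : ℕ}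

lemma IsPDF.isProbabilityMeasure_pdfLaw {f : EuclideanSpace ℝ (Fin d) → ℝ} (hf : IsPDF f) :
    IsProbabilityMeasure (pdfLaw f) := by
  constructor
  rw [pdfLaw, withDensity_apply _ MeasurableSet.univ, Measure.restrict_univ,
    ← ofReal_integral_eq_lintegral_ofReal hf.integrable (ae_of_all _ hf.nonneg),
    hf.integral_eq_one, ENNReal.ofReal_one]

lemma integrable_id_of_hasLaw {V : Type*} [NormedAddCommGroup V] [MeasurableSpace V]
    [BorelSpace V] [SecondCountableTopology V] {Ω : Type*} [MeasurableSpace Ω] {μ : Measure Ω}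
    [IsProbabilityMeasure μ] {X : Ω → V} {P : Measure V} (hX : HasLaw X P μ)
    (hmom : ∫⁻ ω, ‖X ω‖ₑ ^ 2 ∂μ < ⊤) : Integrable id P := by
  have hm : AEStronglyMeasurable X μ := hX.aemeasurable.aestronglyMeasurable
  have h2 : MemLp X 2 μ := by
    refine ⟨hm, (eLpNorm_lt_top_iff_lintegral_rpow_enorm_lt_top two_ne_zero
      ENNReal.ofNat_ne_top).2 ?_⟩
    simpa using hmom
  rw [← hX.map_eq, integrable_map_measure aestronglyMeasurable_id hX.aemeasurable]
  exact h2.integrable one_le_two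

lemma vStat_delta_one {n m : ℕ} (x y : ℕ → EuclideanSpace ℝ (Fin d)) :
    vStat (delta 1) (fun i : Fin n => x i) (fun j : Fin m => y j) =
      2 * ((∑ i ∈ Finset.range n, ∑ j ∈ Finset.range m, ‖x i - y j‖) / ((n : ℝ) * m)) -
      (∑ i ∈ Finset.range n, ∑ j ∈ Finset.range n, ‖x i - x j‖) / ((n : ℝ) * n) -
      (∑ i ∈ Finset.range m, ∑ j ∈ Finset.range m, ‖y i - y j‖) / ((m : ℝ) * m) := by
  simp only [vStat, delta, Real.rpow_one, Finset.sum_range]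
  ring

end EnergyABC

open EnergyABC in
theorem mainTheorem3 {d : ℕ} {Θ : Type*} (f : Θ → EuclideanSpace ℝ (Fin d) → ℝ)
    (hf : ∀ θ, EnergyABC.IsPDF (f θ)) (θ₀ θ : Θ)
    {Ω : Type*} [MeasurableSpace Ω] (μ : Measure Ω) [IsProbabilityMeasure μ]
    (X Y : ℕ → Ω → EuclideanSpace ℝ (Fin d))
    (hX : EnergyABC.IsIIDWithPDF X (f θ₀) μ)
    (hY : EnergyABC.IsIIDWithPDF Y (f θ) μ)
    (hXY : IndepFun (fun ω i => X i ω) (fun ω j => Y j ω) μ)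
    (k l : ℕ)
    (hmom : (∫⁻ ω, ‖X k ω‖ₑ ^ 2 ∂μ) + (∫⁻ ω, ‖Y l ω‖ₑ ^ 2 ∂μ) < ⊤) :
    EnergyABC.EnergyStatExists (EnergyABC.delta 1) (X k) (Y l) μ ∧
    (∀ᵐ ω ∂μ, Tendsto
      (fun p : ℕ × ℕ => EnergyABC.vStat (EnergyABC.delta 1)
        (fun i : Fin p.1 => X i ω) (fun j : Fin p.2 => Y j ω))
      (comap (fun p : ℕ × ℕ => min p.1 p.2) atTop)
      (𝓝 (EnergyABC.energyStat (EnergyABC.delta 1) (X k) (Y l) μ))) ∧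
    Integrable (fun t : EuclideanSpace ℝ (Fin d) =>
      ‖EnergyABC.pdfCharFun (f θ₀) t - EnergyABC.pdfCharFun (f θ) t‖ ^ 2 / ‖t‖ ^ (d + 1)) ∧
    EnergyABC.energyStat (EnergyABC.delta 1) (X k) (Y l) μ =
      Real.Gamma (((d : ℝ) + 1) / 2) / Real.pi ^ (((d : ℝ) + 1) / 2) *
        ∫ t : EuclideanSpace ℝ (Fin d),
          ‖EnergyABC.pdfCharFun (f θ₀) t - EnergyABC.pdfCharFun (f θ) t‖ ^ 2 /
            ‖t‖ ^ (d + 1) := by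
  have hP := (hf θ₀).isProbabilityMeasure_pdfLaw
  have hQ := (hf θ).isProbabilityMeasure_pdfLaw
  obtain ⟨hmX, hmY⟩ := ENNReal.add_lt_top.1 hmom
  have iP := integrable_id_of_hasLaw (hX.law k) hmX
  have iQ := integrable_id_of_hasLaw (hY.law l) hmY
  have iPQ := integrable_norm_sub_prod iP iQ
  have iPP := integrable_norm_sub_prod iP iP
  have iQQ := integrable_norm_sub_prod iQ iQ
  have hfr : Module.finrank ℝ (EuclideanSpace ℝ (Fin d)) = d := finrank_euclideanSpace_fin
  simp only [EnergyStatExists, energyStat, (hX.law k).map_eq, (hY.law l).map_eq, delta,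
    Real.rpow_one]
  refine ⟨⟨iPQ, iPP, iQQ⟩, ?_, ?_, ?_⟩
  · filter_upwards [ae_empTendsto hX.indep hX.law iP, ae_empTendsto hY.indep hY.law iQ]
      with ω hx hy
    have hfst : Tendsto (Prod.fst : ℕ × ℕ → ℕ)
        (comap (fun p : ℕ × ℕ => min p.1 p.2) atTop) atTop :=
      tendsto_atTop_mono (fun p => min_le_left p.1 p.2) tendsto_comap
    have hsnd : Tendsto (Prod.snd : ℕ × ℕ → ℕ)
        (comap (fun p : ℕ × ℕ => min p.1 p.2) atTop) atTop :=
      tendsto_atTop_mono (fun p => min_le_right p.1 p.2) tendsto_comap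
    -- The within-sample terms are double means of a sequence with itself along the index pairs `(n,
    -- n)` and `(m, m)`.
    have h := ((((tendsto_doubleMean_norm iP iQ hx hy).comp (hfst.prodMk hsnd)).const_mul 2).sub
      ((tendsto_doubleMean_norm iP iP hx hx).comp (hfst.prodMk hfst))).sub
      ((tendsto_doubleMean_norm iQ iQ hy hy).comp (hsnd.prodMk hsnd))
    refine h.congr fun p => ?_
    exact (vStat_delta_one (fun i => X i ω) (fun j => Y j ω)).symm
  · have := integrable_norm_charFun_sub_sq_div iPQ iPP iQQ
    rwa [hfr] at this
  · have h := integral_norm_charFun_sub_sq_div iPQ iPP iQQ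
    have hc : normConst (EuclideanSpace ℝ (Fin d)) ≠ 0 := normConst_pos.ne'
    rw [hfr] at h
    rw [← inv_div (Real.pi ^ (((d : ℝ) + 1) / 2))]
    rw [normConst, hfr] at h hc
    simp only [pdfCharFun]
    rw [h, inv_mul_cancel_left₀ hc]
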